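/- Let $Y_1,Y_2,\dots$ be i.i.d. real random variables, let $1\le\alpha<2$, and suppose that $P(Y_1^2>x)\sim \ell(x)x^{-\alpha}$ as $x\to\infty$, where $\ell$ is slowly varying at infinity (positive and measurable on some half-line, with $\ell(cx)/\ell(x)\to1$ as $x\to\infty$ for every $c>0$). Assume that $\sigma_Y^2:=E Y_1^2<\infty$. Put $V_n=\big(\sum_{k=1}^n Y_k^2\big)^{1/2}$ and $\delta_{1,n}=Y_1/V_n$ (with $\delta_{1,n}=0$ where $V_n=0$). Then, for every $\gamma>\alpha$, $$ n\,E|\delta_{1,n}|^{2\gamma}\;\sim\;\frac{\Gamma(\gamma-\alpha)\,\Gamma(1+\alpha)}{\sigma_Y^{2\alpha}\,\Gamma(\gamma)}\;n^{1-\alpha}\,\ell(n)\qquad(n\to\infty). $$ -/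

import Mathlib

open MeasureTheory ProbabilityTheory Filter Asymptotics

noncomputable section

/-- `ℓ` is slowly varying at infinity: on some half-line it is positive and measurable, and
`ℓ (c * x) / ℓ x → 1` as `x → ∞` for every `c > 0`. -/
structure SlowlyVarying (ℓ : ℝ → ℝ) : Prop where
  pos_measurable : ∃ A : ℝ, (∀ x, A ≤ x → 0 < ℓ x) ∧ Measurable (fun x : Set.Ici A => ℓ x)
  tendsto_ratio : ∀ c : ℝ, 0 < c → Tendsto (fun x : ℝ => ℓ (c * x) / ℓ x) atTop (nhds 1)

/-- The random variables `Y 0, Y 1, …` are independent and identically distributed under `μ`. -/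
structure IsIID {Ω : Type*} [MeasurableSpace Ω] (Y : ℕ → Ω → ℝ) (μ : Measure Ω) : Prop where
  indep : iIndepFun Y μ
  identDistrib : ∀ k, IdentDistrib (Y k) (Y 0) μ μ

/-- `V_n = (∑ Y_k²)^{1/2}`, the sum running over the first `n` variables `Y 0, …, Y (n - 1)`. -/
def selfNorm {Ω : Type*} (Y : ℕ → Ω → ℝ) (n : ℕ) (ω : Ω) : ℝ :=
  Real.sqrt (∑ k ∈ Finset.range n, Y k ω ^ 2)

/-- The normalized variable `Y_k / V_n`, with indices starting at `0`. It is `0` where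
`V_n = 0`. -/
def normalized {Ω : Type*} (Y : ℕ → Ω → ℝ) (k n : ℕ) (ω : Ω) : ℝ :=
  Y k ω / selfNorm Y n ω

end

/-!
With `X k = Y k ^ 2`, the moment `E |δ_{1,n}| ^ (2γ)` is `E (X 0 / (X 0 + S n)) ^ γ`, where
`S n = X 1 + ⋯ + X (n - 1)` is independent of `X 0`. If `S n` were a constant `s`, the layer cake
formula would give `γ ∫₀¹ v ^ (γ - 1) P(X 0 > s v / (1 - v)) dv`, which is asymptotic to
`P(X 0 > s)` times a beta integral: regular variation gives the pointwise limit of the tail ratios,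
and Potter's bound dominates them. The law of large numbers suggests `s = n E (X 0)`. The share is
decreasing in `S n`, so the only obstruction to this replacement is the event `S n ≤ r n` with
`r < E (X 0)`; as the summands are nonnegative, Chernoff's bound makes it exponentially rare,
whereas the tail of `X 0` decays no faster than a power.
-/

section RegularVariation

/-- `f` is regularly varying at infinity with index `ρ`. Measurability is not part of the
notion: where it is needed, `f` is monotone. -/
structure IsRegularlyVarying (f : ℝ → ℝ) (ρ : ℝ) : Prop where
  eventually_pos : ∀ᶠ x in atTop, 0 < f x
  tendsto_ratio : ∀ c : ℝ, 0 < c → Tendsto (fun x => f (c * x) / f x) atTop (nhds (c ^ ρ))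

theorem SlowlyVarying.isRegularlyVarying {ℓ : ℝ → ℝ} (hℓ : SlowlyVarying ℓ) :
    IsRegularlyVarying ℓ 0 where
  eventually_pos := by
    obtain ⟨A, hA, -⟩ := hℓ.pos_measurable
    exact eventually_atTop.2 ⟨A, hA⟩
  tendsto_ratio c hc := by simpa only [Real.rpow_zero] using hℓ.tendsto_ratio c hc

theorem isRegularlyVarying_rpow (ρ : ℝ) : IsRegularlyVarying (fun x => x ^ ρ) ρ where
  eventually_pos := (eventually_gt_atTop 0).mono fun _ hx => Real.rpow_pos_of_pos hx ρ
  tendsto_ratio c hc := by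
    refine tendsto_const_nhds.congr' ?_
    filter_upwards [eventually_gt_atTop 0] with x hx
    rw [Real.mul_rpow hc.le hx.le, mul_div_cancel_right₀ _ (Real.rpow_pos_of_pos hx ρ).ne']

namespace IsRegularlyVarying

variable {f g : ℝ → ℝ} {ρ σ : ℝ}

theorem mul (hf : IsRegularlyVarying f ρ) (hg : IsRegularlyVarying g σ) :
    IsRegularlyVarying (fun x => f x * g x) (ρ + σ) where
  eventually_pos := by
    filter_upwards [hf.eventually_pos, hg.eventually_pos] with x hfx hgx using mul_pos hfx hgx
  tendsto_ratio c hc := by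
    simpa only [mul_div_mul_comm, Real.rpow_add hc] using
      (hf.tendsto_ratio c hc).mul (hg.tendsto_ratio c hc)

theorem congr_isEquivalent (hf : IsRegularlyVarying f ρ) (hgf : g ~[atTop] f) :
    IsRegularlyVarying g ρ where
  eventually_pos := hgf.eventually_pos hf.eventually_pos
  tendsto_ratio c hc := by
    have hcx : Tendsto (fun x : ℝ => c * x) atTop atTop := tendsto_id.const_mul_atTop hc
    exact ((hgf.comp_tendsto hcx).div hgf).symm.tendsto_nhds (hf.tendsto_ratio c hc)

end IsRegularlyVarying

theorem le_rpow_mul_of_antitone_of_doubling {G : ℝ → ℝ} (hG : Antitone G) {β x₀ x y : ℝ}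
    (hβ : 0 ≤ β) (hx₀ : 0 < x₀) (hdoubling : ∀ z, x₀ ≤ z → G z ≤ 2 ^ β * G (2 * z))
    (hx : x₀ ≤ x) (hxy : x ≤ y) (hy : 0 ≤ G y) : G x ≤ 2 ^ β * (y / x) ^ β * G y := by
  have hx_pos : 0 < x := hx₀.trans_le hx
  have iterated_doubling (k : ℕ) : G x ≤ ((2 : ℝ) ^ k) ^ β * G (2 ^ k * x) := by
    induction k with
    | zero => simp
    | succ k ih =>
      have hk : x₀ ≤ 2 ^ k * x :=
        hx.trans (le_mul_of_one_le_left hx_pos.le (one_le_pow₀ one_le_two))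
      calc G x ≤ ((2 : ℝ) ^ k) ^ β * G (2 ^ k * x) := ih
        _ ≤ ((2 : ℝ) ^ k) ^ β * (2 ^ β * G (2 * (2 ^ k * x))) := by gcongr; exact hdoubling _ hk
        _ = ((2 : ℝ) ^ (k + 1)) ^ β * G (2 ^ (k + 1) * x) := by
          rw [← mul_assoc, ← Real.mul_rpow (by positivity) zero_le_two, ← pow_succ, ← mul_assoc,
            ← pow_succ']
  obtain ⟨k, hk_le, hk_lt⟩ := exists_nat_pow_near ((one_le_div hx_pos).2 hxy) (one_lt_two (α := ℝ))
  calc G x ≤ ((2 : ℝ) ^ (k + 1)) ^ β * G (2 ^ (k + 1) * x) := iterated_doubling _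
    _ ≤ ((2 : ℝ) ^ (k + 1)) ^ β * G y := by gcongr; exact hG ((div_lt_iff₀ hx_pos).1 hk_lt).le
    _ = 2 ^ β * ((2 : ℝ) ^ k) ^ β * G y := by
      rw [pow_succ', Real.mul_rpow zero_le_two (by positivity)]
    _ ≤ 2 ^ β * (y / x) ^ β * G y := by gcongr

namespace IsRegularlyVarying

variable {G : ℝ → ℝ} {α β γ : ℝ}

theorem pos_of_antitone (hG : IsRegularlyVarying G α) (hanti : Antitone G) (x : ℝ) : 0 < G x := by
  obtain ⟨y, hy, hxy⟩ := (hG.eventually_pos.and (eventually_ge_atTop x)).exists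
  exact hy.trans_le (hanti hxy)

theorem nonneg_of_antitone (hG : IsRegularlyVarying G (-α)) (hanti : Antitone G) : 0 ≤ α := by
  have hle : (2 : ℝ) ^ (-α) ≤ 1 := by
    refine le_of_tendsto (hG.tendsto_ratio 2 two_pos) ?_
    filter_upwards [eventually_ge_atTop 0] with x hx
    exact div_le_one_of_le₀ (hanti (by linarith)) (hG.pos_of_antitone hanti x).le
  by_contra! hα
  exact hle.not_gt (Real.one_lt_rpow one_lt_two (neg_pos.2 hα))

theorem exists_potter_bound (hG : IsRegularlyVarying G (-α)) (hanti : Antitone G) (hαβ : α < β) :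
    ∃ x₀ > 0, ∀ x y, x₀ ≤ x → x ≤ y → G x ≤ 2 ^ β * (y / x) ^ β * G y := by
  have hlt : (2 : ℝ) ^ (-β) < 2 ^ (-α) :=
    Real.rpow_lt_rpow_of_exponent_lt one_lt_two (neg_lt_neg hαβ)
  obtain ⟨x₁, hx₁⟩ := eventually_atTop.1
    ((hG.tendsto_ratio 2 two_pos).eventually (lt_mem_nhds hlt))
  have hdoubling (z : ℝ) (hz : x₁ ≤ z) : G z ≤ 2 ^ β * G (2 * z) := by
    have h := (hx₁ z hz).le
    rwa [le_div_iff₀ (hG.pos_of_antitone hanti z), Real.rpow_neg zero_le_two,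
      inv_mul_le_iff₀ (by positivity)] at h
  refine ⟨max x₁ 1, by positivity, fun x y hx hxy => ?_⟩
  exact le_rpow_mul_of_antitone_of_doubling hanti ((hG.nonneg_of_antitone hanti).trans hαβ.le)
    (by positivity) (fun z hz => hdoubling z ((le_max_left _ _).trans hz)) hx hxy
    (hG.pos_of_antitone hanti y).le

theorem rpow_neg_isBigO (hG : IsRegularlyVarying G (-α)) (hanti : Antitone G) (hαβ : α < β) :
    (fun x => x ^ (-β)) =O[atTop] G := by
  obtain ⟨x₀, hx₀, hle⟩ := hG.exists_potter_bound hanti hαβ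
  have hGx₀ := hG.pos_of_antitone hanti x₀
  refine IsBigO.of_bound ((G x₀)⁻¹ * 2 ^ β * (x₀ ^ β)⁻¹) ?_
  filter_upwards [eventually_ge_atTop x₀] with x hx
  have hx_pos : 0 < x := hx₀.trans_le hx
  rw [Real.norm_of_nonneg (by positivity), Real.norm_of_nonneg (hG.pos_of_antitone hanti x).le]
  calc x ^ (-β) = (G x₀)⁻¹ * x ^ (-β) * G x₀ := by field_simp
    _ ≤ (G x₀)⁻¹ * x ^ (-β) * (2 ^ β * (x / x₀) ^ β * G x) := by
      gcongr
      exact hle x₀ x le_rfl hx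
    _ = (G x₀)⁻¹ * 2 ^ β * (x₀ ^ β)⁻¹ * G x := by
      rw [Real.div_rpow hx_pos.le hx₀.le, Real.rpow_neg hx_pos.le]
      field_simp

theorem exists_potter_bound_unit_interval (hG : IsRegularlyVarying G (-α)) (hanti : Antitone G)
    (hαβ : α < β) :
    ∃ K, ∀ᶠ x in atTop, ∀ u, 0 < u → u ≤ 1 → G (u * x) ≤ K * u ^ (-β) * G x := by
  have hβ : 0 ≤ β := (hG.nonneg_of_antitone hanti).trans hαβ.le
  obtain ⟨x₀, hx₀, hle⟩ := hG.exists_potter_bound hanti hαβ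
  have hG_pos := hG.pos_of_antitone hanti
  have hG₀ : 1 ≤ G 0 / G x₀ := (one_le_div (hG_pos x₀)).2 (hanti hx₀.le)
  refine ⟨G 0 / G x₀ * 2 ^ β, ?_⟩
  filter_upwards [eventually_ge_atTop x₀] with x hx u hu hu1
  have hx_pos : 0 < x := hx₀.trans_le hx
  have hGx := (hG_pos x).le
  have hG₀_nonneg : 0 ≤ G 0 / G x₀ := zero_le_one.trans hG₀
  rw [Real.rpow_neg hu.le, ← Real.inv_rpow hu.le]
  rcases le_total x₀ (u * x) with hux | hux
  · calc G (u * x) ≤ 2 ^ β * (x / (u * x)) ^ β * G x :=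
          hle _ _ hux (mul_le_of_le_one_left hx_pos.le hu1)
      _ = 1 * 2 ^ β * u⁻¹ ^ β * G x := by rw [div_mul_cancel_right₀ hx_pos.ne', one_mul]
      _ ≤ G 0 / G x₀ * 2 ^ β * u⁻¹ ^ β * G x := by gcongr
  · have hxu : x / x₀ ≤ u⁻¹ := by
      rw [div_le_iff₀ hx₀, inv_mul_eq_div, le_div_iff₀ hu, mul_comm]
      exact hux
    calc G (u * x) ≤ G 0 := hanti (by positivity)
      _ = G 0 / G x₀ * G x₀ := (div_mul_cancel₀ _ (hG_pos x₀).ne').symm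
      _ ≤ G 0 / G x₀ * (2 ^ β * (x / x₀) ^ β * G x) :=
          mul_le_mul_of_nonneg_left (hle _ _ le_rfl hx) hG₀_nonneg
      _ ≤ G 0 / G x₀ * (2 ^ β * u⁻¹ ^ β * G x) := by gcongr
      _ = G 0 / G x₀ * 2 ^ β * u⁻¹ ^ β * G x := by ring

theorem tendsto_setIntegral_rpow_mul_ratio (hG : IsRegularlyVarying G (-α)) (hanti : Antitone G)
    (hαγ : α < γ) :
    Tendsto (fun s => ∫ v in Set.Ioo (0 : ℝ) 1, v ^ (γ - 1) * (G (v / (1 - v) * s) / G s))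
      atTop (nhds (∫ v in Set.Ioo (0 : ℝ) 1, v ^ (γ - 1) * (v / (1 - v)) ^ (-α))) := by
  obtain ⟨β, hαβ, hβγ⟩ := exists_between hαγ
  obtain ⟨K, hK⟩ := hG.exists_potter_bound_unit_interval hanti hαβ
  refine tendsto_integral_filter_of_dominated_convergence (fun v => K * v ^ (γ - β - 1)) ?_ ?_ ?_ ?_
  · have hmeas := hanti.measurable
    exact Eventually.of_forall fun s => (by fun_prop : Measurable _).aestronglyMeasurable
  · filter_upwards [hK, eventually_ge_atTop 0] with s hs hs0
    refine ae_restrict_of_forall_mem measurableSet_Ioo fun v ⟨hv0, hv1⟩ => ?_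
    have hGs := hG.pos_of_antitone hanti s
    have hGvs := hG.pos_of_antitone hanti (v / (1 - v) * s)
    have hv_le : v ≤ v / (1 - v) := le_div_self hv0.le (sub_pos.2 hv1) (by linarith)
    have hratio : G (v / (1 - v) * s) / G s ≤ K * v ^ (-β) := by
      rw [div_le_iff₀ hGs]
      exact (hanti (by gcongr)).trans (hs v hv0 hv1.le)
    rw [Real.norm_of_nonneg (by positivity)]
    calc v ^ (γ - 1) * (G (v / (1 - v) * s) / G s) ≤ v ^ (γ - 1) * (K * v ^ (-β)) := by gcongr
      _ = K * v ^ (γ - β - 1) := by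
        rw [show γ - β - 1 = γ - 1 + -β by ring, Real.rpow_add hv0]
        ring
  · exact ((intervalIntegral.integrableOn_Ioo_rpow_iff one_pos).2 (by linarith)).const_mul K
  · refine ae_restrict_of_forall_mem measurableSet_Ioo fun v ⟨hv0, hv1⟩ => ?_
    exact (hG.tendsto_ratio _ (div_pos hv0 (sub_pos.2 hv1))).const_mul _

end IsRegularlyVarying

end RegularVariation

section BetaIntegral

theorem setIntegral_rpow_mul_one_sub_rpow {a b : ℝ} (ha : 0 < a) (hb : 0 < b) :
    ∫ v in Set.Ioo (0 : ℝ) 1, v ^ (a - 1) * (1 - v) ^ (b - 1) = beta a b := by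
  have hbeta := beta_pos ha hb
  have hlintegral : ∫⁻ v in Set.Ioo (0 : ℝ) 1,
      ENNReal.ofReal (1 / beta a b * v ^ (a - 1) * (1 - v) ^ (b - 1)) = 1 :=
    lintegral_betaPDF.symm.trans (lintegral_betaPDF_eq_one ha hb)
  have hintegral : ∫ v in Set.Ioo (0 : ℝ) 1,
      1 / beta a b * v ^ (a - 1) * (1 - v) ^ (b - 1) = 1 := by
    rw [integral_eq_lintegral_of_nonneg_ae _
      (by fun_prop : Measurable _).aestronglyMeasurable, hlintegral, ENNReal.toReal_one]
    refine ae_restrict_of_forall_mem measurableSet_Ioo fun v ⟨hv0, hv1⟩ => ?_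
    have := sub_pos.2 hv1
    simp only [Pi.zero_apply]
    positivity
  simp only [mul_assoc] at hintegral
  rwa [integral_const_mul, one_div, inv_mul_eq_one₀ hbeta.ne', eq_comm] at hintegral

theorem mul_setIntegral_rpow_mul_div_one_sub_rpow {α γ : ℝ} (hα : -1 < α) (hαγ : α < γ)
    (hγ : 0 < γ) :
    γ * ∫ v in Set.Ioo (0 : ℝ) 1, v ^ (γ - 1) * (v / (1 - v)) ^ (-α) =
      Real.Gamma (γ - α) * Real.Gamma (1 + α) / Real.Gamma γ := by
  have hintegrand : ∫ v in Set.Ioo (0 : ℝ) 1, v ^ (γ - 1) * (v / (1 - v)) ^ (-α) =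
      ∫ v in Set.Ioo (0 : ℝ) 1, v ^ (γ - α - 1) * (1 - v) ^ (1 + α - 1) := by
    refine setIntegral_congr_fun measurableSet_Ioo fun v ⟨hv0, hv1⟩ => ?_
    have hv1' : 0 < 1 - v := sub_pos.2 hv1
    rw [Real.div_rpow hv0.le hv1'.le, Real.rpow_neg hv1'.le, div_inv_eq_mul,
      show γ - α - 1 = γ - 1 + -α by ring, Real.rpow_add hv0, add_sub_cancel_left, mul_assoc]
  have hGamma := (Real.Gamma_pos_of_pos hγ).ne'
  rw [hintegrand, setIntegral_rpow_mul_one_sub_rpow (sub_pos.2 hαγ) (by linarith), beta,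
    show γ - α + (1 + α) = γ + 1 by ring, Real.Gamma_add_one hγ.ne']
  field_simp

end BetaIntegral

section ShareMoment

theorem div_add_nonneg {x s : ℝ} (hx : 0 ≤ x) (hs : 0 ≤ s) : 0 ≤ x / (x + s) :=
  div_nonneg hx (add_nonneg hx hs)

theorem div_add_le_one {x s : ℝ} (hx : 0 ≤ x) (hs : 0 ≤ s) : x / (x + s) ≤ 1 :=
  div_le_one_of_le₀ (le_add_of_nonneg_right hs) (add_nonneg hx hs)

theorem div_add_le_div_add {x s t : ℝ} (hx : 0 ≤ x) (hs : 0 ≤ s) (hst : s ≤ t) :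
    x / (x + t) ≤ x / (x + s) := by
  rcases hx.eq_or_lt with rfl | hx
  · simp
  · gcongr

variable {Ω : Type*} [MeasurableSpace Ω] {μ : Measure Ω} {X S : Ω → ℝ} {α γ s : ℝ}

/-- The tail `P(X > x)` of a random variable `X`. -/
noncomputable def tailProb (μ : Measure Ω) (X : Ω → ℝ) (x : ℝ) : ℝ :=
  μ.real {ω | x < X ω}

theorem antitone_tailProb [IsFiniteMeasure μ] (X : Ω → ℝ) : Antitone (tailProb μ X) :=
  fun _ _ hxy => measureReal_mono fun _ hω => lt_of_le_of_lt hxy hω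

theorem integral_pos_of_tailProb_zero_pos (hX : Integrable X μ) (hX0 : 0 ≤ X)
    (hpos : 0 < tailProb μ X 0) : 0 < ∫ ω, X ω ∂μ := by
  rw [integral_pos_iff_support_of_nonneg hX0 hX]
  exact (ENNReal.toReal_pos_iff.1 hpos).1.trans_le (measure_mono fun ω hω => ne_of_gt hω)

theorem integral_rpow_eq_setIntegral_tailProb [IsFiniteMeasure μ] (hX : AEMeasurable X μ)
    (hX0 : 0 ≤ X) (hX1 : X ≤ 1) (hγ : 0 < γ) :
    ∫ ω, X ω ^ γ ∂μ = ∫ v in Set.Ioo (0 : ℝ) 1, γ * (v ^ (γ - 1) * tailProb μ X v) := by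
  have hmeas := (antitone_tailProb (μ := μ) X).measurable
  have hnonneg : 0 ≤ᵐ[volume.restrict (Set.Ioo (0 : ℝ) 1)]
      fun v => γ * (v ^ (γ - 1) * tailProb μ X v) :=
    ae_restrict_of_forall_mem measurableSet_Ioo fun v hv =>
      mul_nonneg hγ.le (mul_nonneg (Real.rpow_nonneg hv.1.le _) measureReal_nonneg)
  have htail_one (v : ℝ) (hv : v ∈ Set.Ici (1 : ℝ)) : μ {ω | v < X ω} = 0 := by
    rw [show {ω | v < X ω} = ∅ from
      Set.eq_empty_of_forall_notMem fun ω => not_lt.2 ((hX1 ω).trans hv), measure_empty]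
  rw [integral_eq_lintegral_of_nonneg_ae
      (Eventually.of_forall fun ω => Real.rpow_nonneg (hX0 ω) γ)
      (hX.pow_const γ).aestronglyMeasurable,
    integral_eq_lintegral_of_nonneg_ae hnonneg (by fun_prop : Measurable _).aestronglyMeasurable]
  congr 1
  rw [lintegral_rpow_eq_lintegral_meas_lt_mul μ (Eventually.of_forall hX0) hX hγ,
    ← lintegral_const_mul' _ _ ENNReal.ofReal_ne_top, ← Set.Ioo_union_Ici_eq_Ioi (zero_lt_one' ℝ),
    lintegral_union measurableSet_Ici
      (Set.disjoint_left.2 fun v hv hv' => not_lt.2 (Set.mem_Ici.1 hv') hv.2),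
    setLIntegral_eq_zero measurableSet_Ici fun v hv => by simp [htail_one v hv], add_zero]
  refine setLIntegral_congr_fun measurableSet_Ioo fun v hv => ?_
  simp only [tailProb]
  rw [ENNReal.ofReal_mul hγ.le, ENNReal.ofReal_mul (Real.rpow_nonneg hv.1.le _),
    ofReal_measureReal, mul_comm (μ _)]

/-- The moment `E (X / (X + S)) ^ γ` of the share of `X` in the total `X + S`, for nonnegative `X`
and `S`. The share is `0` where the total vanishes. -/
noncomputable def shareMoment (μ : Measure Ω) (X S : Ω → ℝ) (γ : ℝ) : ℝ :=
  ∫ ω, (X ω / (X ω + S ω)) ^ γ ∂μ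

theorem integrable_share_rpow [IsFiniteMeasure μ] (hX : AEMeasurable X μ) (hS : AEMeasurable S μ)
    (hX0 : 0 ≤ X) (hS0 : 0 ≤ S) (hγ : 0 ≤ γ) :
    Integrable (fun ω => (X ω / (X ω + S ω)) ^ γ) μ := by
  refine .of_bound (C := 1) ((hX.div (hX.add hS)).pow_const γ).aestronglyMeasurable
    (Eventually.of_forall fun ω => ?_)
  have hshare := div_add_nonneg (hX0 ω) (hS0 ω)
  rw [Real.norm_of_nonneg (Real.rpow_nonneg hshare γ)]
  exact Real.rpow_le_one hshare (div_add_le_one (hX0 ω) (hS0 ω)) hγ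

theorem tailProb_share_const (hX0 : 0 ≤ X) (hs : 0 < s) {v : ℝ} (hv : v < 1) :
    tailProb μ (fun ω => X ω / (X ω + s)) v = tailProb μ X (v / (1 - v) * s) := by
  unfold tailProb
  congr 1 with ω
  have htotal : 0 < X ω + s := add_pos_of_nonneg_of_pos (hX0 ω) hs
  simp only [Set.mem_ofPred_eq]
  rw [lt_div_iff₀ htotal, div_mul_eq_mul_div, div_lt_iff₀ (sub_pos.2 hv)]
  constructor <;> intro h <;> linarith

theorem shareMoment_const_eq_mul_setIntegral [IsFiniteMeasure μ] (hX : AEMeasurable X μ)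
    (hX0 : 0 ≤ X) (hs : 0 < s) (hγ : 0 < γ) :
    shareMoment μ X (fun _ => s) γ =
      γ * ∫ v in Set.Ioo (0 : ℝ) 1, v ^ (γ - 1) * tailProb μ X (v / (1 - v) * s) := by
  have hmeas : AEMeasurable (fun ω => X ω / (X ω + s)) μ := by fun_prop
  rw [shareMoment, integral_rpow_eq_setIntegral_tailProb hmeas
    (fun ω => div_add_nonneg (hX0 ω) hs.le) (fun ω => div_add_le_one (hX0 ω) hs.le) hγ,
    integral_const_mul]
  congr 1
  refine setIntegral_congr_fun measurableSet_Ioo fun v hv => ?_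
  simp only [tailProb_share_const hX0 hs hv.2]

theorem tendsto_shareMoment_const_div_tailProb [IsFiniteMeasure μ] (hX : AEMeasurable X μ)
    (hX0 : 0 ≤ X) (hG : IsRegularlyVarying (tailProb μ X) (-α)) (hαγ : α < γ) :
    Tendsto (fun s => shareMoment μ X (fun _ => s) γ / tailProb μ X s) atTop
      (nhds (Real.Gamma (γ - α) * Real.Gamma (1 + α) / Real.Gamma γ)) := by
  have hα := hG.nonneg_of_antitone (antitone_tailProb X)
  have hγ : 0 < γ := hα.trans_lt hαγ
  have hlim := (hG.tendsto_setIntegral_rpow_mul_ratio (antitone_tailProb X) hαγ).const_mul γ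
  rw [mul_setIntegral_rpow_mul_div_one_sub_rpow (by linarith) hαγ hγ] at hlim
  refine hlim.congr' ?_
  filter_upwards [eventually_gt_atTop 0] with s hs
  rw [shareMoment_const_eq_mul_setIntegral hX hX0 hs hγ, mul_div_assoc, ← integral_div]
  simp only [mul_div_assoc]

theorem shareMoment_le_const_add [IsFiniteMeasure μ] (hX : AEMeasurable X μ)
    (hS : AEMeasurable S μ) (hX0 : 0 ≤ X) (hS0 : 0 ≤ S) (hs : 0 ≤ s) (hγ : 0 ≤ γ) :
    shareMoment μ X S γ ≤ shareMoment μ X (fun _ => s) γ + μ.real {ω | S ω ≤ s} := by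
  have hmeas : NullMeasurableSet {ω | S ω ≤ s} μ := nullMeasurableSet_le hS aemeasurable_const
  have hconst := integrable_share_rpow hX aemeasurable_const hX0 (fun _ => hs) hγ
  have hindicator : Integrable ({ω | S ω ≤ s}.indicator (1 : Ω → ℝ)) μ :=
    (integrable_const 1).indicator₀ hmeas
  have hmeasure : μ.real {ω | S ω ≤ s} = ∫ ω, {ω | S ω ≤ s}.indicator (1 : Ω → ℝ) ω ∂μ := by
    simp [integral_indicator₀ hmeas]
  rw [hmeasure, shareMoment, shareMoment, ← integral_add hconst hindicator]
  refine integral_mono (integrable_share_rpow hX hS hX0 hS0 hγ) (hconst.add hindicator) fun ω => ?_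
  have hshare := div_add_nonneg (hX0 ω) (hS0 ω)
  simp only
  by_cases hω : S ω ≤ s
  · rw [Set.indicator_of_mem (show ω ∈ {ω | S ω ≤ s} from hω), Pi.one_apply]
    exact (Real.rpow_le_one hshare (div_add_le_one (hX0 ω) (hS0 ω)) hγ).trans
      (le_add_of_nonneg_left (Real.rpow_nonneg (div_add_nonneg (hX0 ω) hs) γ))
  · rw [Set.indicator_of_notMem (show ω ∉ {ω | S ω ≤ s} from hω), add_zero]
    exact Real.rpow_le_rpow hshare (div_add_le_div_add (hX0 ω) hs (not_le.1 hω).le) hγ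

theorem shareMoment_const_mul_le [IsFiniteMeasure μ] (hX : AEMeasurable X μ)
    (hS : AEMeasurable S μ) (hXS : IndepFun X S μ) (hX0 : 0 ≤ X) (hS0 : 0 ≤ S)
    (hs : 0 ≤ s) (hγ : 0 ≤ γ) :
    shareMoment μ X (fun _ => s) γ * μ.real {ω | S ω ≤ s} ≤ shareMoment μ X S γ := by
  set g : ℝ → ℝ := (Set.Iic s).indicator 1
  have hg : Measurable g := measurable_one.indicator measurableSet_Iic
  have hmeasure : μ.real {ω | S ω ≤ s} = ∫ ω, g (S ω) ∂μ := by
    rw [← integral_map hS hg.aestronglyMeasurable, integral_indicator_one measurableSet_Iic,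
      map_measureReal_apply_of_aemeasurable hS measurableSet_Iic]
    rfl
  have hindep : IndepFun (fun ω => (X ω / (X ω + s)) ^ γ) (fun ω => g (S ω)) μ :=
    hXS.comp (φ := fun x => (x / (x + s)) ^ γ) (by fun_prop) hg
  rw [hmeasure, shareMoment, ← hindep.integral_fun_mul_eq_mul_integral
    (integrable_share_rpow hX aemeasurable_const hX0 (fun _ => hs) hγ).aestronglyMeasurable
    (hg.comp_aemeasurable hS).aestronglyMeasurable]
  have hshare (ω : Ω) := Real.rpow_nonneg (div_add_nonneg (hX0 ω) hs) γ
  refine integral_mono_of_nonneg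
    (Eventually.of_forall fun ω => mul_nonneg (hshare ω)
      (Set.indicator_nonneg (fun _ _ => zero_le_one) _))
    (integrable_share_rpow hX hS hX0 hS0 hγ) (Eventually.of_forall fun ω => ?_)
  by_cases hω : S ω ≤ s
  · simp only [g, Set.indicator_of_mem (Set.mem_Iic.2 hω), Pi.one_apply, mul_one]
    exact Real.rpow_le_rpow (div_add_nonneg (hX0 ω) hs) (div_add_le_div_add (hX0 ω) (hS0 ω) hω) hγ
  · simp only [g, Set.indicator_of_notMem (Set.notMem_Iic.2 (not_le.1 hω)), mul_zero]
    exact Real.rpow_nonneg (div_add_nonneg (hX0 ω) (hS0 ω)) γ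

end ShareMoment

theorem tendsto_of_forall_tendsto_bounds {ι : Type*} {l : Filter ι} {u : ι → ℝ} {φ : ℝ → ℝ} {m : ℝ}
    (hφ : ContinuousAt φ m)
    (hlower : ∀ᶠ r in nhdsWithin m (Set.Ioi m), ∃ v, Tendsto v l (nhds (φ r)) ∧ v ≤ᶠ[l] u)
    (hupper : ∀ᶠ r in nhdsWithin m (Set.Iio m), ∃ w, Tendsto w l (nhds (φ r)) ∧ u ≤ᶠ[l] w) :
    Tendsto u l (nhds (φ m)) := by
  refine tendsto_order.2 ⟨fun b hb => ?_, fun b hb => ?_⟩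
  · obtain ⟨r, hbr, v, hv, hvu⟩ :=
      (((hφ.eventually (lt_mem_nhds hb)).filter_mono nhdsWithin_le_nhds).and hlower).exists
    filter_upwards [hv.eventually (lt_mem_nhds hbr), hvu] with i hbv hvu using hbv.trans_le hvu
  · obtain ⟨r, hbr, w, hw, huw⟩ :=
      (((hφ.eventually (gt_mem_nhds hb)).filter_mono nhdsWithin_le_nhds).and hupper).exists
    filter_upwards [hw.eventually (gt_mem_nhds hbr), huw] with i hwb huw using huw.trans_lt hwb

section RandomTotal

variable {Ω : Type*} [MeasurableSpace Ω] {μ : Measure Ω} [IsFiniteMeasure μ] {ι : Type*}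
  {l : Filter ι} {a : ι → ℝ} {X : Ω → ℝ} {S : ι → Ω → ℝ} {α γ m r : ℝ}

theorem tendsto_shareMoment_const_mul_div_tailProb (ha : Tendsto a l atTop)
    (hX : AEMeasurable X μ) (hX0 : 0 ≤ X) (hG : IsRegularlyVarying (tailProb μ X) (-α))
    (hαγ : α < γ) (hr : 0 < r) :
    Tendsto (fun i => shareMoment μ X (fun _ => r * a i) γ / tailProb μ X (a i)) l
      (nhds (Real.Gamma (γ - α) * Real.Gamma (1 + α) / Real.Gamma γ * r ^ (-α))) := by
  have hmoment := (tendsto_shareMoment_const_div_tailProb hX hX0 hG hαγ).comp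
    (ha.const_mul_atTop hr)
  refine (hmoment.mul ((hG.tendsto_ratio r hr).comp ha)).congr fun i => ?_
  exact div_mul_div_cancel₀ (hG.pos_of_antitone (antitone_tailProb X) _).ne'

/-- If `S i / a i → m` in probability, then `S i` may be replaced by `m * a i` in the share moment,
provided that `S i` is unlikely to be small at the scale of the tail of `X`: that event contributes
to the share moment up to its full probability. -/
theorem tendsto_shareMoment_div_tailProb (ha : Tendsto a l atTop)
    (hX : AEMeasurable X μ) (hS : ∀ i, AEMeasurable (S i) μ) (hXS : ∀ i, IndepFun X (S i) μ)
    (hX0 : 0 ≤ X) (hS0 : ∀ i, 0 ≤ S i) (hG : IsRegularlyVarying (tailProb μ X) (-α))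
    (hαγ : α < γ) (hm : 0 < m)
    (hbelow : ∀ r < m, (fun i => μ.real {ω | S i ω ≤ r * a i}) =o[l] fun i => tailProb μ X (a i))
    (habove : ∀ r > m, Tendsto (fun i => μ.real {ω | S i ω ≤ r * a i}) l (nhds 1)) :
    Tendsto (fun i => shareMoment μ X (S i) γ / tailProb μ X (a i)) l
      (nhds (Real.Gamma (γ - α) * Real.Gamma (1 + α) / Real.Gamma γ * m ^ (-α))) := by
  have hγ : 0 ≤ γ := (hG.nonneg_of_antitone (antitone_tailProb X)).trans hαγ.le
  have htail_nonneg (i : ι) : 0 ≤ tailProb μ X (a i) := measureReal_nonneg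
  have hconst {r : ℝ} := tendsto_shareMoment_const_mul_div_tailProb (r := r) ha hX hX0 hG hαγ
  refine tendsto_of_forall_tendsto_bounds
    (φ := fun r => Real.Gamma (γ - α) * Real.Gamma (1 + α) / Real.Gamma γ * r ^ (-α))
    (continuousAt_const.mul (Real.continuousAt_rpow_const m (-α) (Or.inl hm.ne'))) ?_ ?_
  · filter_upwards [self_mem_nhdsWithin] with r (hmr : m < r)
    have hr := hm.trans hmr
    refine ⟨_, by simpa only [mul_one] using (hconst hr).mul (habove r hmr), ?_⟩
    filter_upwards [ha.eventually_ge_atTop 0] with i hi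
    rw [div_mul_eq_mul_div]
    exact div_le_div_of_nonneg_right (shareMoment_const_mul_le hX (hS i) (hXS i) hX0 (hS0 i)
      (mul_nonneg hr.le hi) hγ) (htail_nonneg i)
  · filter_upwards [self_mem_nhdsWithin, (lt_mem_nhds hm).filter_mono nhdsWithin_le_nhds]
      with r (hrm : r < m) hr
    refine ⟨_, by simpa only [add_zero] using
      (hconst hr).add (hbelow r hrm).tendsto_div_nhds_zero, ?_⟩
    filter_upwards [ha.eventually_ge_atTop 0] with i hi
    rw [← add_div]
    exact div_le_div_of_nonneg_right (shareMoment_le_const_add hX (hS i) hX0 (hS0 i)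
      (mul_nonneg hr.le hi) hγ) (htail_nonneg i)

end RandomTotal

section LaplaceTransform

variable {Ω : Type*} [MeasurableSpace Ω] {μ : Measure Ω} {X : Ω → ℝ}

theorem integrable_exp_neg_mul_of_nonneg [IsFiniteMeasure μ] (hX : AEMeasurable X μ) (hX0 : 0 ≤ X)
    {t : ℝ} (ht : 0 ≤ t) : Integrable (fun ω => Real.exp (-t * X ω)) μ := by
  simpa only [Pi.neg_apply, mul_neg, neg_mul] using integrable_exp_mul_of_le (X := -X) t 0 ht hX.neg
    (Eventually.of_forall fun ω => neg_nonpos.2 (hX0 ω))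

theorem tendsto_one_sub_mgf_neg_div [IsProbabilityMeasure μ] (hX : Integrable X μ) (hX0 : 0 ≤ X) :
    Tendsto (fun t => (1 - mgf X μ (-t)) / t) (nhdsWithin 0 (Set.Ioi 0))
      (nhds (∫ ω, X ω ∂μ)) := by
  have hXm := hX.aemeasurable
  have hlim : Tendsto (fun t : ℝ => ∫ ω, (1 - Real.exp (-t * X ω)) / t ∂μ)
      (nhdsWithin 0 (Set.Ioi 0)) (nhds (∫ ω, X ω ∂μ)) := by
    refine tendsto_integral_filter_of_dominated_convergence X
      (Eventually.of_forall fun t => by fun_prop) ?_ hX (Eventually.of_forall fun ω => ?_)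
    · filter_upwards [self_mem_nhdsWithin] with t (ht : 0 < t)
      refine Eventually.of_forall fun ω => ?_
      have hexp_le_one : Real.exp (-t * X ω) ≤ 1 :=
        Real.exp_le_one_iff.2 (mul_nonpos_of_nonpos_of_nonneg (neg_nonpos.2 ht.le) (hX0 ω))
      rw [Real.norm_of_nonneg (div_nonneg (sub_nonneg.2 hexp_le_one) ht.le), div_le_iff₀ ht]
      linarith [Real.add_one_le_exp (-t * X ω)]
    · have hderiv : HasDerivAt (fun t : ℝ => 1 - Real.exp (-t * X ω)) (X ω) 0 := by
        simpa using (((hasDerivAt_id (0 : ℝ)).neg.mul_const (X ω)).exp).const_sub 1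
      refine ((hasDerivAt_iff_tendsto_slope.1 hderiv).mono_left
        (nhdsWithin_mono 0 fun t ht => ne_of_gt ht)).congr fun t => ?_
      simp [slope_def_field]
  refine hlim.congr' ?_
  filter_upwards [self_mem_nhdsWithin] with t (ht : 0 < t)
  rw [integral_div, integral_sub (integrable_const _)
    (integrable_exp_neg_mul_of_nonneg hXm hX0 ht.le), integral_const, probReal_univ, one_smul, mgf]

theorem exists_mgf_neg_le_exp [IsProbabilityMeasure μ] (hX : Integrable X μ) (hX0 : 0 ≤ X) {c : ℝ}
    (hc : c < ∫ ω, X ω ∂μ) : ∃ t > 0, mgf X μ (-t) ≤ Real.exp (-(t * c)) := by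
  obtain ⟨t, hct, ht : 0 < t⟩ := (((tendsto_one_sub_mgf_neg_div hX hX0).eventually
    (lt_mem_nhds hc)).and self_mem_nhdsWithin).exists
  rw [lt_div_iff₀ ht] at hct
  exact ⟨t, ht, by linarith [Real.add_one_le_exp (-(t * c))]⟩

end LaplaceTransform

theorem tendsto_measureReal_le_of_tendstoInMeasure {Ω : Type*} [MeasurableSpace Ω]
    {μ : Measure Ω} [IsProbabilityMeasure μ] {ι : Type*} {l : Filter ι} {f : ι → Ω → ℝ} {m r : ℝ}
    (hf : TendstoInMeasure μ f l fun _ => m) (hmr : m < r) :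
    Tendsto (fun i => μ.real {ω | f i ω ≤ r}) l (nhds 1) := by
  have hfar := tendstoInMeasure_iff_measureReal_dist.1 hf (r - m) (sub_pos.2 hmr)
  refine tendsto_of_tendsto_of_tendsto_of_le_of_le (by simpa only [sub_zero] using hfar.const_sub 1)
    tendsto_const_nhds (fun i => ?_) fun i => measureReal_le_one
  have hcover : Set.univ ⊆ {ω | f i ω ≤ r} ∪ {ω | r - m ≤ dist (f i ω) m} := fun ω _ =>
    (le_or_gt (f i ω) r).imp id fun h =>
      (sub_le_sub_right h.le m).trans (le_abs_self (f i ω - m))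
  have := (measureReal_mono (μ := μ) hcover).trans (measureReal_union_le _ _)
  rw [probReal_univ] at this
  simp only
  linarith

section IID

variable {Ω : Type*} [MeasurableSpace Ω] {μ : Measure Ω} {r : ℝ}

theorem exists_measureReal_sum_le_le_exp {ι : Type*} {X : ι → Ω → ℝ} {i₀ : ι}
    [IsProbabilityMeasure μ] (hindep : iIndepFun X μ)
    (hident : ∀ i, IdentDistrib (X i) (X i₀) μ μ) (hX0 : ∀ i, 0 ≤ X i) (hint : Integrable (X i₀) μ)
    {c : ℝ} (hc : c < ∫ ω, X i₀ ω ∂μ) :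
    ∃ t > 0, ∀ (s : Finset ι) (a : ℝ),
      μ.real {ω | ∑ i ∈ s, X i ω ≤ a} ≤ Real.exp (t * (a - c * s.card)) := by
  obtain ⟨t, ht, hmgf⟩ := exists_mgf_neg_le_exp hint (hX0 i₀) hc
  have hXm (i : ι) : AEMeasurable (X i) μ := (hident i).aemeasurable_fst
  refine ⟨t, ht, fun s a => ?_⟩
  have hmgf_sum : mgf (∑ i ∈ s, X i) μ (-t) = mgf (X i₀) μ (-t) ^ s.card := by
    rw [hindep.mgf_sum₀ hXm, Finset.prod_congr rfl
      fun i _ => mgf_congr_of_identDistrib (X i) (X i₀) (hident i) (-t), Finset.prod_const]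
  calc μ.real {ω | ∑ i ∈ s, X i ω ≤ a}
      = μ.real {ω | (∑ i ∈ s, X i) ω ≤ a} := by simp only [Finset.sum_apply]
    _ ≤ Real.exp (- -t * a) * mgf (∑ i ∈ s, X i) μ (-t) :=
      measure_le_le_exp_mul_mgf a (neg_nonpos.2 ht.le)
        (integrable_exp_neg_mul_of_nonneg (Finset.aemeasurable_sum s fun i _ => hXm i)
          (Finset.sum_nonneg fun i _ => hX0 i) ht.le)
    _ ≤ Real.exp (- -t * a) * Real.exp (-(t * c)) ^ s.card := by
      rw [hmgf_sum]
      gcongr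
      exact mgf_nonneg
    _ = Real.exp (t * (a - c * s.card)) := by
      rw [← Real.exp_nat_mul, ← Real.exp_add]
      ring_nf

variable {X : ℕ → Ω → ℝ}

theorem isLittleO_measureReal_sum_Ico_le_rpow [IsProbabilityMeasure μ] (hindep : iIndepFun X μ)
    (hident : ∀ k, IdentDistrib (X k) (X 0) μ μ) (hX0 : ∀ k, 0 ≤ X k) (hint : Integrable (X 0) μ)
    (hr : r < ∫ ω, X 0 ω ∂μ) (p : ℝ) :
    (fun n : ℕ => μ.real {ω | ∑ k ∈ Finset.Ico 1 n, X k ω ≤ r * n}) =o[atTop]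
      fun n : ℕ => (n : ℝ) ^ p := by
  obtain ⟨c, hrc, hc⟩ := exists_between hr
  obtain ⟨t, ht, hchernoff⟩ := exists_measureReal_sum_le_le_exp hindep hident hX0 hint hc
  refine IsBigO.trans_isLittleO (IsBigO.of_bound (Real.exp (t * c)) ?_)
    ((isLittleO_exp_neg_mul_rpow_atTop (mul_pos ht (sub_pos.2 hrc)) p).comp_tendsto
      tendsto_natCast_atTop_atTop)
  filter_upwards [eventually_ge_atTop 1] with n hn
  rw [Real.norm_of_nonneg measureReal_nonneg, Function.comp_apply,
    Real.norm_of_nonneg (Real.exp_pos _).le, ← Real.exp_add]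
  refine (hchernoff (Finset.Ico 1 n) (r * n)).trans_eq ?_
  rw [Nat.card_Ico, Nat.cast_sub hn]
  push_cast
  ring_nf

theorem tendsto_measureReal_sum_Ico_le [IsProbabilityMeasure μ] (hindep : iIndepFun X μ)
    (hident : ∀ k, IdentDistrib (X k) (X 0) μ μ) (hX0 : ∀ k, 0 ≤ X k) (hint : Integrable (X 0) μ)
    (hr : ∫ ω, X 0 ω ∂μ < r) :
    Tendsto (fun n : ℕ => μ.real {ω | ∑ k ∈ Finset.Ico 1 n, X k ω ≤ r * n}) atTop (nhds 1) := by
  have hXm (k : ℕ) : AEMeasurable (X k) μ := (hident k).aemeasurable_fst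
  have hmean : TendstoInMeasure μ (fun (n : ℕ) ω => (∑ k ∈ Finset.range n, X k ω) / n) atTop
      fun _ => ∫ ω, X 0 ω ∂μ :=
    tendstoInMeasure_of_tendsto_ae
      (fun n => ((Finset.aemeasurable_fun_sum _ fun k _ => hXm k).div_const _).aestronglyMeasurable)
      (strong_law_ae_real X hint (fun _ _ hij => hindep.indepFun hij) hident)
  refine tendsto_of_tendsto_of_tendsto_of_le_of_le'
    (tendsto_measureReal_le_of_tendstoInMeasure hmean hr) tendsto_const_nhds ?_
    (Eventually.of_forall fun n => measureReal_le_one)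
  filter_upwards [eventually_gt_atTop 0] with n hn
  refine measureReal_mono fun ω hω => ?_
  calc ∑ k ∈ Finset.Ico 1 n, X k ω ≤ ∑ k ∈ Finset.range n, X k ω := by
        rw [Finset.range_eq_Ico]
        exact Finset.sum_le_sum_of_subset_of_nonneg (Finset.Ico_subset_Ico_left zero_le_one)
          fun k _ _ => hX0 k ω
    _ ≤ r * n := (div_le_iff₀ (Nat.cast_pos.2 hn)).1 hω

theorem integral_div_sum_rpow_eq_shareMoment {n : ℕ} (hn : 0 < n) (γ : ℝ) :
    ∫ ω, (X 0 ω / ∑ k ∈ Finset.range n, X k ω) ^ γ ∂μ =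
      shareMoment μ (X 0) (fun ω => ∑ k ∈ Finset.Ico 1 n, X k ω) γ := by
  simp only [shareMoment, Finset.range_eq_Ico, Finset.sum_eq_sum_Ico_succ_bot hn, zero_add]

theorem isEquivalent_integral_div_sum_rpow [IsProbabilityMeasure μ] {α γ : ℝ}
    (hindep : iIndepFun X μ) (hident : ∀ k, IdentDistrib (X k) (X 0) μ μ) (hX0 : ∀ k, 0 ≤ X k)
    (hint : Integrable (X 0) μ) (hG : IsRegularlyVarying (tailProb μ (X 0)) (-α)) (hαγ : α < γ) :
    (fun n : ℕ => ∫ ω, (X 0 ω / ∑ k ∈ Finset.range n, X k ω) ^ γ ∂μ) ~[atTop]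
      fun n : ℕ => Real.Gamma (γ - α) * Real.Gamma (1 + α) /
        ((∫ ω, X 0 ω ∂μ) ^ α * Real.Gamma γ) * tailProb μ (X 0) n := by
  have hXm (k : ℕ) : AEMeasurable (X k) μ := (hident k).aemeasurable_fst
  have hα := hG.nonneg_of_antitone (antitone_tailProb (X 0))
  have htail_pos := hG.pos_of_antitone (antitone_tailProb (X 0))
  have hm := integral_pos_of_tailProb_zero_pos hint (hX0 0) (htail_pos 0)
  have hindep_rest (n : ℕ) : IndepFun (X 0) (fun ω => ∑ k ∈ Finset.Ico 1 n, X k ω) μ := by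
    simpa only [← Finset.sum_apply] using
      (hindep.indepFun_finsetSum_of_notMem₀ hXm (s := Finset.Ico 1 n) (i := 0) (by simp)).symm
  have hlim := tendsto_shareMoment_div_tailProb tendsto_natCast_atTop_atTop (hXm 0)
    (fun n => Finset.aemeasurable_fun_sum (Finset.Ico 1 n) fun k _ => hXm k) hindep_rest (hX0 0)
    (fun n ω => Finset.sum_nonneg fun k _ => hX0 k ω) hG hαγ hm
    (fun r hr => (isLittleO_measureReal_sum_Ico_le_rpow hindep hident hX0 hint hr
      (-(α + 1))).trans_isBigO ((hG.rpow_neg_isBigO (antitone_tailProb (X 0))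
        (lt_add_one α)).comp_tendsto tendsto_natCast_atTop_atTop))
    (fun r hr => tendsto_measureReal_sum_Ico_le hindep hident hX0 hint hr)
  have hconst_pos : 0 < Real.Gamma (γ - α) * Real.Gamma (1 + α) / Real.Gamma γ *
      (∫ ω, X 0 ω ∂μ) ^ (-α) := by
    have := Real.Gamma_pos_of_pos (sub_pos.2 hαγ)
    have := Real.Gamma_pos_of_pos (show 0 < 1 + α by linarith)
    have := Real.Gamma_pos_of_pos (hα.trans_lt hαγ)
    positivity
  refine ((((isEquivalent_const_iff_tendsto hconst_pos.ne').2 hlim).mul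
    (IsEquivalent.refl (u := fun n : ℕ => tailProb μ (X 0) n))).congr_left ?_).congr_right ?_
  · filter_upwards [eventually_gt_atTop 0] with n hn
    rw [Pi.mul_apply, div_mul_cancel₀ _ (htail_pos n).ne', integral_div_sum_rpow_eq_shareMoment hn]
  · refine Eventually.of_forall fun n => ?_
    simp only [Pi.mul_apply, Function.const_apply]
    rw [Real.rpow_neg hm.le, ← div_eq_mul_inv, div_div, mul_comm (Real.Gamma γ)]

end IID

theorem abs_normalized_rpow {Ω : Type*} (Y : ℕ → Ω → ℝ) (k n : ℕ) (ω : Ω) (γ : ℝ) :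
    |normalized Y k n ω| ^ (2 * γ) = (Y k ω ^ 2 / ∑ j ∈ Finset.range n, Y j ω ^ 2) ^ γ := by
  rw [Real.rpow_mul (abs_nonneg _), Real.rpow_two, sq_abs, normalized, selfNorm, div_pow,
    Real.sq_sqrt (Finset.sum_nonneg fun j _ => sq_nonneg _)]

theorem mainTheorem6_general {Ω : Type*} [MeasurableSpace Ω] (μ : Measure Ω)
    [IsProbabilityMeasure μ] (Y : ℕ → Ω → ℝ) (hY : IsIID Y μ) (α : ℝ)
    (ℓ : ℝ → ℝ) (hℓ : IsRegularlyVarying ℓ 0)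
    (htail : (fun x : ℝ => μ.real {ω | x < Y 0 ω ^ 2}) ~[atTop] (fun x : ℝ => ℓ x * x ^ (-α)))
    (hvar : Integrable (fun ω => Y 0 ω ^ 2) μ) (γ : ℝ) (hγ : α < γ) :
    (fun n : ℕ => (n : ℝ) * ∫ ω, |normalized Y 0 n ω| ^ (2 * γ) ∂μ) ~[atTop]
      (fun n : ℕ => Real.Gamma (γ - α) * Real.Gamma (1 + α) /
          ((∫ ω, Y 0 ω ^ 2 ∂μ) ^ α * Real.Gamma γ) *
        (n : ℝ) ^ (1 - α) * ℓ (n : ℝ)) := by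
  have hsq : Measurable fun y : ℝ => y ^ 2 := by fun_prop
  have hG : IsRegularlyVarying (tailProb μ fun ω => Y 0 ω ^ 2) (-α) := by
    have hproduct := (hℓ.mul (isRegularlyVarying_rpow (-α))).congr_isEquivalent htail
    rwa [zero_add] at hproduct
  have hshare := isEquivalent_integral_div_sum_rpow (X := fun k ω => Y k ω ^ 2)
    (hY.indep.comp (fun _ y => y ^ 2) fun _ => hsq) (fun k => (hY.identDistrib k).comp hsq)
    (fun k ω => sq_nonneg (Y k ω)) hvar hG hγ
  simp only [abs_normalized_rpow]
  refine (IsEquivalent.refl.mul (hshare.trans (IsEquivalent.refl.mul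
    (htail.comp_tendsto tendsto_natCast_atTop_atTop)))).congr_right ?_
  filter_upwards [eventually_gt_atTop 0] with n hn
  simp only [Pi.mul_apply, Function.comp_apply]
  rw [sub_eq_add_neg 1 α, Real.rpow_add (Nat.cast_pos.2 hn), Real.rpow_one]
  ring

theorem mainTheorem6 {Ω : Type*} [MeasurableSpace Ω] (μ : Measure Ω) [IsProbabilityMeasure μ]
    (Y : ℕ → Ω → ℝ) (hY : IsIID Y μ)
    (α : ℝ) (hα₁ : 1 ≤ α) (hα₂ : α < 2)
    (ℓ : ℝ → ℝ) (hℓ : SlowlyVarying ℓ)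
    (htail : (fun x : ℝ => μ.real {ω | x < Y 0 ω ^ 2}) ~[atTop] (fun x : ℝ => ℓ x * x ^ (-α)))
    (hvar : Integrable (fun ω => Y 0 ω ^ 2) μ)
    (γ : ℝ) (hγ : α < γ) :
    (fun n : ℕ => (n : ℝ) * ∫ ω, |normalized Y 0 n ω| ^ (2 * γ) ∂μ) ~[atTop]
      (fun n : ℕ => Real.Gamma (γ - α) * Real.Gamma (1 + α) /
          ((∫ ω, Y 0 ω ^ 2 ∂μ) ^ α * Real.Gamma γ) *
        (n : ℝ) ^ (1 - α) * ℓ (n : ℝ)) :=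
  mainTheorem6_general μ Y hY α ℓ hℓ.isRegularlyVarying htail hvar γ hγ
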